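/- Let $m\ge 1$, let $g_1\ge g_2\ge\dots\ge g_m$ be real numbers, and let $B_1,\dots,B_m$ be independent Brownian motions of rate two (quadratic variation $2t$) on $[0,\infty)$ with continuous paths, started from the origin. For $1\le k\le l\le m$ and $t\ge 0$ let $$B[(0,l)\to(t,k)]=\sup_\pi\Big(B_k(t)-B_k(t_k)+\sum_{i=k+1}^{l}\big(B_i(t_{i-1})-B_i(t_i)\big)\Big)$$ be the last passage value, where the supremum is over the non-increasing integer-valued functions $\pi$ on $[0,t]$, càdlàg on $(0,t)$, with $\pi(0)=l$ and $\pi(t)=k$, and $t_i=\inf\{s\in[0,t]:\pi(s)\le i\}$ is the time at which $\pi$ jumps from level $i+1$ to level $i$ (so $t_l=0$); for $t=0$ the value is $0$. Let $$H_k(t)=\max_{k\le l\le m}\big(g_l+B[(0,l)\to(t,k)]\big),\qquad t\ge 0,\ 1\le k\le m,$$ be the Brownian TASEP started from $(g_1,\dots,g_m)$, and for $1\le k<m$ let $T_k=\inf\{t\ge 0: H_k(t)=H_{k+1}(t)\}\in[0,\infty]$. Then there are continuous non-decreasing processes $\alpha^1,\dots,\alpha^{m-1}$, started from $0$ and adapted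 to the filtration generated by $B_1,\dots,B_m$, such that for every $1\le k<m$: (i) almost surely, the Stieltjes measure $d\alpha^k$ is supported on $\{s\ge0: H_k(s)=H_{k+1}(s)\}$; (ii) almost surely, for all $t\ge 0$, $$H_k(t)=g_k+B_k(t)+\alpha^k(t)=g_k+B_k(t)+\int_{(0,t]}\mathbf 1_{[T_k,\infty)}(s)\,d\alpha^k(s);$$ (iii) if $g_k>g_{k+1}$, then $T_k>0$ almost surely. Moreover, for every $1\le k\le m$, $H_k$ is a continuous semimartingale (the sum of a continuous local martingale and a continuous adapted process of finite variation) with respect to the filtration generated by $B_1,\dots,B_m$. -/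

import Mathlib

open MeasureTheory ProbabilityTheory Set
open scoped NNReal ENNReal

noncomputable section

namespace BrownianTASEP

/-! ### Last passage percolation -/

/-- `π` restricted to `[x, y]` is a path from `(x, l)` to `(y, k)`: a non-increasing,
integer-valued function with `π x = l` and `π y = k` which is càdlàg on `(x, y)`
(left limits exist automatically, by monotonicity). -/
structure IsPath (x y : ℝ≥0) (l k : ℕ) (π : ℝ≥0 → ℕ) : Prop where
  antitone : AntitoneOn π (Icc x y)
  right_cont : ∀ s ∈ Ioo x y, ContinuousWithinAt π (Ici s) s
  start : π x = l
  finish : π y = k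

/-- The time in `[x, y]` at which the path `π` jumps from level `i + 1` to level `i`, i.e. the first
time at which it is at level `i` or below. (Several of these times coincide if `π` skips levels.) -/
def jumpTime (x y : ℝ≥0) (π : ℝ≥0 → ℕ) (i : ℕ) : ℝ≥0 :=
  sInf {s | s ∈ Icc x y ∧ π s ≤ i}

/-- Length of a path `π` from `(x, l)` to `(y, k)` in the environment `f`: the sum over the levels
`i = k, …, l` of the increment of `f i` over the time that `π` spends at level `i`. The first jump
time `jumpTime x y π l` is `x`. -/
def pathLength (f : ℕ → ℝ≥0 → ℝ) (x y : ℝ≥0) (l k : ℕ) (π : ℝ≥0 → ℕ) : ℝ :=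
  f k y - f k (jumpTime x y π k) +
    ∑ i ∈ Finset.Ioc k l, (f i (jumpTime x y π (i - 1)) - f i (jumpTime x y π i))

/-- The last passage value `f[(x, l) → (y, k)]`: the supremum of the lengths of all paths.
For `x = y` and `k < l` there is no path, and the value is `sSup ∅ = 0`, which is the usual
convention (and the limit as `y ↓ x`). -/
def lastPassage (f : ℕ → ℝ≥0 → ℝ) (x : ℝ≥0) (l : ℕ) (y : ℝ≥0) (k : ℕ) : ℝ :=
  sSup (pathLength f x y l k '' {π | IsPath x y l k π})

/-! ### Brownian motions and Brownian TASEP -/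

variable {Ω : Type*} [mΩ : MeasurableSpace Ω]

/-- A Brownian motion of rate two started from the origin: `√2` times a standard one. -/
def IsRateTwoBrownian (X : ℝ≥0 → Ω → ℝ) (P : Measure Ω) : Prop :=
  IsBrownianReal (fun t ω ↦ (√2)⁻¹ * X t ω) P

/-- Line `k` (`1 ≤ k ≤ m`) of the Brownian TASEP with `m` lines driven by `B 1, …, B m` and started
from `g 1, …, g m`: `H_k(t) = max_{k ≤ l ≤ m} (g l + B[(0, l) → (t, k)])`. -/
def line (m : ℕ) (g : ℕ → ℝ) (B : ℕ → ℝ≥0 → Ω → ℝ) (k : ℕ) (t : ℝ≥0) (ω : Ω) : ℝ :=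
  ⨆ l : Finset.Icc k m, (g l + lastPassage (fun i s ↦ B i s ω) 0 l t k)

/-- The first collision time `inf {t ≥ 0 | X t = Y t}` of two paths (`∞` if they never meet). -/
def collisionTime (X Y : ℝ≥0 → ℝ) : ℝ≥0∞ :=
  ⨅ (t : ℝ≥0) (_ : X t = Y t), (t : ℝ≥0∞)

/-- The filtration generated by `B 1, …, B m`. -/
def drivingFiltration (m : ℕ) (B : ℕ → ℝ≥0 → Ω → ℝ)
    (hB : ∀ i ∈ Finset.Icc 1 m, ∀ t, Measurable (B i t)) : Filtration ℝ≥0 mΩ :=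
  Filtration.natural (fun t ω (i : Finset.Icc 1 m) ↦ B i.1 t ω)
    (fun t ↦ (measurable_pi_lambda _ fun i : Finset.Icc 1 m ↦ hB i.1 i.2 t).stronglyMeasurable)

/-! ### Continuous semimartingales -/

/-- `M` is a continuous local martingale with respect to `𝓕`. -/
structure IsContinuousLocalMartingale (M : ℝ≥0 → Ω → ℝ) (𝓕 : Filtration ℝ≥0 mΩ)
    (P : Measure Ω) : Prop where
  adapted : StronglyAdapted 𝓕 M
  continuous : ∀ ω, Continuous fun t ↦ M t ω
  local_martingale : Locally (fun X ↦ Martingale X 𝓕 P) 𝓕 M P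

/-- `A` is a continuous adapted process started from `0` whose paths have finite variation on
compact intervals. -/
structure IsContinuousFiniteVariation (A : ℝ≥0 → Ω → ℝ) (𝓕 : Filtration ℝ≥0 mΩ) : Prop where
  adapted : StronglyAdapted 𝓕 A
  continuous : ∀ ω, Continuous fun t ↦ A t ω
  zero : ∀ ω, A 0 ω = 0
  finite_variation : ∀ ω, LocallyBoundedVariationOn (fun t ↦ A t ω) univ

/-- `X` is a continuous semimartingale with respect to `𝓕`. -/
def IsContinuousSemimartingale (X : ℝ≥0 → Ω → ℝ) (𝓕 : Filtration ℝ≥0 mΩ) (P : Measure Ω) : Prop :=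
  ∃ M A : ℝ≥0 → Ω → ℝ, IsContinuousLocalMartingale M 𝓕 P ∧ IsContinuousFiniteVariation A 𝓕 ∧
    ∀ t ω, X t ω = M t ω + A t ω

end BrownianTASEP

end

/-! Apart from the martingale property, the argument is pathwise. Splitting a path at its last jump
gives the last passage value to level `k` as `f k t` plus the supremum over `s ≤ t` of (value to
level `k + 1` at time `s`) minus `f k s`; so last passage values are the iterated running suprema
`passage` (`lastPassage_eq_passage`).

The maximum over starting levels commutes with the supremum over `s`. Hence `H_k = g_k + (B_k -
B_k(0)) + α^k`, where `α^k` is the running supremum of the positive part of `H_{k+1} - (g_k + B_k -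
B_k(0))`: line `k` is the free motion reflected off line `k + 1` (`pathLine_eq_add_push`). A running
supremum is monotone, continuous, determined by the past, and grows only where its argument attains
it, that is, where the two lines meet (`exists_push_le`).

Finally, `B_k` is a martingale in the joint filtration because its increments are independent of the
past of all the lines (`martingale_sub_zero`); adding the monotone `α^k` gives the semimartingale.
-/

namespace BrownianTASEP

/-! ### Running suprema -/

/-- The running supremum of `Z` over `[0, t]`. -/
noncomputable def runSup (Z : ℝ≥0 → ℝ) (t : ℝ≥0) : ℝ := sSup (Z '' Icc 0 t)

lemma le_runSup {Z : ℝ≥0 → ℝ} (hZ : Continuous Z) {s t : ℝ≥0} (hst : s ≤ t) :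
    Z s ≤ runSup Z t :=
  le_csSup (isCompact_Icc.image hZ).bddAbove (mem_image_of_mem _ ⟨zero_le, hst⟩)

lemma exists_eq_runSup {Z : ℝ≥0 → ℝ} (hZ : Continuous Z) (t : ℝ≥0) :
    ∃ s ≤ t, Z s = runSup Z t := by
  obtain ⟨s, hs, h⟩ := (isCompact_Icc.image hZ).sSup_mem
    ((nonempty_Icc.2 (zero_le (a := t))).image Z)
  exact ⟨s, hs.2, h⟩

lemma runSup_mono {Z : ℝ≥0 → ℝ} (hZ : Continuous Z) : Monotone (runSup Z) := by
  intro a b hab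
  obtain ⟨s, hs, h⟩ := exists_eq_runSup hZ a
  exact h ▸ le_runSup hZ (hs.trans hab)

lemma runSup_zero (Z : ℝ≥0 → ℝ) : runSup Z 0 = Z 0 := by
  simp [runSup]

lemma continuous_runSup {Z : ℝ≥0 → ℝ} (hZ : Continuous Z) : Continuous (runSup Z) := by
  -- Rescaling time turns the moving interval `[0, t]` into the fixed compact `[0, 1]`.
  have h : runSup Z = fun t ↦ sSup ((fun t r : ℝ≥0 ↦ Z (r * t)) t '' Icc 0 1) := by
    ext t
    refine congrArg sSup (Subset.antisymm ?_ ?_)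
    · rintro _ ⟨s, hs, rfl⟩
      rcases eq_or_ne t 0 with rfl | ht
      · exact ⟨0, by simp, by simp [nonpos_iff_eq_zero.1 hs.2]⟩
      · exact ⟨s / t, ⟨zero_le, div_le_one_of_le₀ hs.2 zero_le⟩, by simp [div_mul_cancel₀ _ ht]⟩
    · rintro _ ⟨r, hr, rfl⟩
      exact ⟨r * t, ⟨zero_le, mul_le_of_le_one_left zero_le hr.2⟩, rfl⟩
  rw [h]
  exact isCompact_Icc.continuous_sSup (by fun_prop)

/-- Used for adaptedness: stopping at `t` lets one countable dense sequence serve every `t` while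
evaluating `Z` only at times up to `t`. -/
lemma runSup_eq_iSup_denseSeq {Z : ℝ≥0 → ℝ} (hZ : Continuous Z) (t : ℝ≥0) :
    runSup Z t = ⨆ n, Z (min t (TopologicalSpace.denseSeq ℝ≥0 n)) := by
  have hle (u : ℝ≥0) : Z (min t u) ≤ runSup Z t := le_runSup hZ (min_le_left _ _)
  have hbdd : BddAbove (range fun n ↦ Z (min t (TopologicalSpace.denseSeq ℝ≥0 n))) :=
    ⟨runSup Z t, by rintro _ ⟨n, rfl⟩; exact hle _⟩
  refine le_antisymm ?_ (ciSup_le fun n ↦ hle _)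
  obtain ⟨s, hs, h⟩ := exists_eq_runSup hZ t
  have hclosed : IsClosed {u | Z (min t u) ≤
      ⨆ n, Z (min t (TopologicalSpace.denseSeq ℝ≥0 n))} :=
    isClosed_le (by fun_prop) continuous_const
  have hs' : s ∈ {u | Z (min t u) ≤ ⨆ n, Z (min t (TopologicalSpace.denseSeq ℝ≥0 n))} :=
    closure_minimal (by rintro _ ⟨n, rfl⟩; exact le_ciSup hbdd n) hclosed
      (TopologicalSpace.denseRange_denseSeq ℝ≥0 s)
  rwa [mem_ofPred_eq, min_eq_right hs, h] at hs'

/-! ### Last passage values as iterated running suprema -/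

/-- `passage f k n t` is the last passage value from `(0, k + n)` to `(t, k)`, defined by optimising
over the last jump time. -/
noncomputable def passage (f : ℕ → ℝ≥0 → ℝ) : ℕ → ℕ → ℝ≥0 → ℝ
  | k, 0 => fun t ↦ f k t - f k 0
  | k, n + 1 => fun t ↦ f k t + runSup (fun s ↦ passage f (k + 1) n s - f k s) t

lemma continuous_passage {f : ℕ → ℝ≥0 → ℝ} {k n : ℕ}
    (hf : ∀ i, k ≤ i → i ≤ k + n → Continuous (f i)) : Continuous (passage f k n) := by
  induction n generalizing k with
  | zero => exact (hf k le_rfl le_rfl).sub continuous_const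
  | succ n ih =>
    have hk := hf k le_rfl (by omega)
    exact hk.add (continuous_runSup ((ih fun i h1 h2 ↦ hf i (by omega) (by omega)).sub hk))

lemma passage_zero (f : ℕ → ℝ≥0 → ℝ) (k n : ℕ) : passage f k n 0 = 0 := by
  induction n generalizing k with
  | zero => simp [passage]
  | succ n ih => simp [passage, runSup_zero, ih]

/-- The sequences of jump times of paths from `(0, l)` to `(t, k)`. -/
structure IsChain (l : ℕ) (t : ℝ≥0) (k : ℕ) (τ : ℕ → ℝ≥0) : Prop where
  antitone : AntitoneOn τ (Icc k l)
  start : τ l = 0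
  finish : τ k ≤ t

/-- The length of a path with jump times `τ`. -/
noncomputable def chainLength (f : ℕ → ℝ≥0 → ℝ) (l : ℕ) (t : ℝ≥0) (k : ℕ) (τ : ℕ → ℝ≥0) : ℝ :=
  f k t - f k (τ k) + ∑ i ∈ Finset.Ioc k l, (f i (τ (i - 1)) - f i (τ i))

lemma chainLength_step (f : ℕ → ℝ≥0 → ℝ) {k l : ℕ} (hkl : k < l) (t : ℝ≥0) (τ : ℕ → ℝ≥0) :
    chainLength f l t k τ = f k t - f k (τ k) + chainLength f l (τ k) (k + 1) τ := by
  have : Finset.Ioc k l = insert (k + 1) (Finset.Ioc (k + 1) l) := by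
    ext i; simp only [Finset.mem_Ioc, Finset.mem_insert]; omega
  rw [chainLength, chainLength, this, Finset.sum_insert (by simp)]
  simp

lemma chainLength_congr (f : ℕ → ℝ≥0 → ℝ) {k l : ℕ} (hkl : k ≤ l) (t : ℝ≥0) {τ σ : ℕ → ℝ≥0}
    (h : ∀ i, k ≤ i → i ≤ l → τ i = σ i) : chainLength f l t k τ = chainLength f l t k σ := by
  rw [chainLength, chainLength, h k le_rfl hkl]
  congr 1
  refine Finset.sum_congr rfl fun i hi ↦ ?_
  rw [Finset.mem_Ioc] at hi
  rw [h i (by omega) hi.2, h (i - 1) (by omega) (by omega)]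

lemma chainLength_le_passage {f : ℕ → ℝ≥0 → ℝ} {k n : ℕ}
    (hf : ∀ i, k ≤ i → i ≤ k + n → Continuous (f i)) {t : ℝ≥0} {τ : ℕ → ℝ≥0}
    (hτ : IsChain (k + n) t k τ) : chainLength f (k + n) t k τ ≤ passage f k n t := by
  induction n generalizing k t with
  | zero =>
    have := hτ.start
    simp only [add_zero] at this
    simp [chainLength, passage, this]
  | succ n ih =>
    have e : k + (n + 1) = k + 1 + n := by omega
    have hf' : ∀ i, k + 1 ≤ i → i ≤ k + 1 + n → Continuous (f i) :=
      fun i h1 h2 ↦ hf i (by omega) (by omega)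
    have hk := hf k le_rfl (by omega)
    rw [chainLength_step f (by omega), passage]
    have hτ' : IsChain (k + 1 + n) (τ k) (k + 1) τ :=
      ⟨hτ.antitone.mono (Icc_subset_Icc (by omega) (by omega)), e ▸ hτ.start,
        hτ.antitone ⟨le_rfl, by omega⟩ ⟨by omega, by omega⟩ (by omega)⟩
    have h1 := ih hf' hτ'
    have h2 : passage f (k + 1) n (τ k) - f k (τ k) ≤ _ :=
      le_runSup ((continuous_passage hf').sub hk) hτ.finish
    rw [e]
    change _ ≤ f k t + runSup (passage f (k + 1) n - f k) t
    linarith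

lemma exists_chainLength_eq_passage {f : ℕ → ℝ≥0 → ℝ} {k n : ℕ}
    (hf : ∀ i, k ≤ i → i ≤ k + n → Continuous (f i)) (t : ℝ≥0) :
    ∃ τ, IsChain (k + n) t k τ ∧ chainLength f (k + n) t k τ = passage f k n t := by
  induction n generalizing k t with
  | zero => exact ⟨fun _ ↦ 0, ⟨fun _ _ _ _ _ ↦ le_rfl, rfl, zero_le⟩, by simp [chainLength, passage]⟩
  | succ n ih =>
    have e : k + (n + 1) = k + 1 + n := by omega
    have hf' : ∀ i, k + 1 ≤ i → i ≤ k + 1 + n → Continuous (f i) :=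
      fun i h1 h2 ↦ hf i (by omega) (by omega)
    have hk := hf k le_rfl (by omega)
    -- The maximiser `s` becomes the last jump time, prepended to an optimal chain for the endpoint
    -- `(s, k + 1)`.
    obtain ⟨s, hs, hmax⟩ := exists_eq_runSup ((continuous_passage hf').sub hk) t
    obtain ⟨τ, hτ, hlen⟩ := ih hf' s
    have hne {i : ℕ} (hi : k + 1 ≤ i) : Function.update τ k s i = τ i :=
      Function.update_of_ne (by omega) _ _
    refine ⟨Function.update τ k s, ⟨?_, ?_, ?_⟩, ?_⟩
    · intro i hi j hj hij
      rcases eq_or_lt_of_le hj.1 with rfl | hkj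
      · rw [le_antisymm hij hi.1]
      rw [hne hkj]
      rcases eq_or_lt_of_le hi.1 with rfl | hki
      · rw [Function.update_self]
        exact (hτ.antitone ⟨le_rfl, by omega⟩ ⟨hkj, e ▸ hj.2⟩ hkj).trans hτ.finish
      · rw [hne hki]
        exact hτ.antitone ⟨hki, e ▸ hi.2⟩ ⟨hkj, e ▸ hj.2⟩ hij
    · rw [hne (by omega), e]; exact hτ.start
    · simpa using hs
    · rw [chainLength_step f (by omega), passage, Function.update_self, e,
        chainLength_congr f (by omega) _ (fun i hi _ ↦ hne hi), hlen]
      change _ = f k t + runSup (passage f (k + 1) n - f k) t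
      rw [← hmax, Pi.sub_apply]
      ring

lemma IsPath.isChain {l k : ℕ} {t : ℝ≥0} {π : ℝ≥0 → ℕ} (hπ : IsPath 0 t l k π) :
    IsChain l t k (jumpTime 0 t π) where
  antitone _ hi _ _ hij :=
    csInf_le_csInf (OrderBot.bddBelow _) ⟨t, ⟨zero_le, le_rfl⟩, hπ.finish.trans_le hi.1⟩
      fun _ hs ↦ ⟨hs.1, hs.2.trans hij⟩
  start := nonpos_iff_eq_zero.1
    (csInf_le (OrderBot.bddBelow _) ⟨⟨le_rfl, zero_le⟩, hπ.start.le⟩)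
  finish := csInf_le (OrderBot.bddBelow _) ⟨⟨zero_le, le_rfl⟩, hπ.finish.le⟩

open Classical in
/-- The path with jump times `τ`. -/
noncomputable def chainPath (l : ℕ) (t : ℝ≥0) (k : ℕ) (τ : ℕ → ℝ≥0) (u : ℝ≥0) : ℕ :=
  -- The endpoint values are forced even when `τ` has jumps at `0` or at `t`; right-continuity is
  -- only required strictly in between.
  if u = 0 then l else if t ≤ u then k else sInf {i | k ≤ i ∧ τ i ≤ u}

section ChainPath

variable {k l : ℕ} {t : ℝ≥0} {τ : ℕ → ℝ≥0}

lemma chainPath_zero : chainPath l t k τ 0 = l := by simp [chainPath]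

lemma chainPath_of_le (ht : 0 < t) {u : ℝ≥0} (hu : t ≤ u) : chainPath l t k τ u = k := by
  simp [chainPath, hu, (ht.trans_le hu).ne']

/-- Since `τ` is antitone, the levels already reached by time `u` are upward closed in `[k, l]`, so
comparing their minimum with `i` amounts to testing `i` itself. -/
lemma chainPath_le_iff (hτ : IsChain l t k τ) (hkl : k ≤ l) {u : ℝ≥0} (hu : u ∈ Ioo 0 t) {i : ℕ}
    (hi : i ≤ l) : chainPath l t k τ u ≤ i ↔ k ≤ i ∧ τ i ≤ u := by
  have hmem : l ∈ {i | k ≤ i ∧ τ i ≤ u} := ⟨hkl, hτ.start ▸ hu.1.le⟩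
  have hval : chainPath l t k τ u = sInf {i | k ≤ i ∧ τ i ≤ u} := by
    simp [chainPath, hu.1.ne', hu.2]
  have hInf := Nat.sInf_mem ⟨l, hmem⟩
  rw [hval]
  refine ⟨fun h ↦ ⟨hInf.1.trans h, ?_⟩, fun h ↦ Nat.sInf_le h⟩
  exact (hτ.antitone ⟨hInf.1, h.trans hi⟩ ⟨hInf.1.trans h, hi⟩ h).trans hInf.2

lemma IsChain.isPath (hτ : IsChain l t k τ) (hkl : k ≤ l) (ht : 0 < t) :
    IsPath 0 t l k (chainPath l t k τ) where
  start := chainPath_zero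
  finish := chainPath_of_le ht le_rfl
  antitone u hu v hv huv := by
    rcases eq_or_lt_of_le hu.1 with rfl | hu0
    · rw [chainPath_zero]
      rcases eq_or_lt_of_le hv.1 with rfl | hv0
      · rw [chainPath_zero]
      rcases eq_or_lt_of_le hv.2 with rfl | hvt
      · rwa [chainPath_of_le ht le_rfl]
      · exact (chainPath_le_iff hτ hkl ⟨hv0, hvt⟩ le_rfl).2 ⟨hkl, hτ.start ▸ hv0.le⟩
    · rcases eq_or_lt_of_le hv.2 with rfl | hvt
      · rw [chainPath_of_le ht le_rfl]
        rcases eq_or_lt_of_le hu.2 with rfl | hut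
        · rw [chainPath_of_le ht le_rfl]
        have hl := (chainPath_le_iff hτ hkl ⟨hu0, hut⟩ le_rfl).2 ⟨hkl, hτ.start ▸ hu0.le⟩
        exact ((chainPath_le_iff hτ hkl ⟨hu0, hut⟩ hl).1 le_rfl).1
      · have hu' : u ∈ Ioo 0 t := ⟨hu0, huv.trans_lt hvt⟩
        have hl := (chainPath_le_iff hτ hkl hu' le_rfl).2 ⟨hkl, hτ.start ▸ hu0.le⟩
        have h := (chainPath_le_iff hτ hkl hu' hl).1 le_rfl
        exact (chainPath_le_iff hτ hkl ⟨hu0.trans_le huv, hvt⟩ hl).2 ⟨h.1, h.2.trans huv⟩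
  right_cont u hu := by
    have hl := (chainPath_le_iff hτ hkl hu le_rfl).2 ⟨hkl, hτ.start ▸ hu.1.le⟩
    obtain ⟨hk, hτu⟩ := (chainPath_le_iff hτ hkl hu hl).1 le_rfl
    set j := chainPath l t k τ u with hj
    -- The jump to level `j - 1` lies strictly after `u`, so the path is constant just to the right
    -- of `u`.
    have hev : ∀ᶠ v in nhdsWithin u (Ici u), chainPath l t k τ v = j := by
      have hbelow : ∀ᶠ v in nhdsWithin u (Ici u), k < j → v < τ (j - 1) := by
        by_cases hkj : k < j
        · have : u < τ (j - 1) := by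
            by_contra! h
            have := (chainPath_le_iff hτ hkl hu (i := j - 1) (by omega)).2 ⟨by omega, h⟩
            omega
          filter_upwards [nhdsWithin_le_nhds (Iio_mem_nhds this)] with v hv _ using hv
        · exact .of_forall fun v h ↦ absurd h hkj
      filter_upwards [self_mem_nhdsWithin, nhdsWithin_le_nhds (Iio_mem_nhds hu.2), hbelow]
        with v huv hvt hv
      have hv' : v ∈ Ioo 0 t := ⟨hu.1.trans_le huv, hvt⟩
      refine le_antisymm ((chainPath_le_iff hτ hkl hv' hl).2 ⟨hk, hτu.trans huv⟩) ?_
      by_contra! hlt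
      have h := (chainPath_le_iff hτ hkl hv' (i := j - 1) (by omega)).1 (by omega)
      exact (hv (by omega)).not_ge h.2
    exact tendsto_const_nhds.congr' (hev.mono fun v hv ↦ hv.symm)

lemma jumpTime_chainPath (hτ : IsChain l t k τ) (ht : 0 < t) {i : ℕ} (hki : k ≤ i)
    (hil : i ≤ l) : jumpTime 0 t (chainPath l t k τ) i = τ i := by
  have hkl := hki.trans hil
  have hit : τ i ≤ t := (hτ.antitone ⟨le_rfl, hkl⟩ ⟨hki, hil⟩ hki).trans hτ.finish
  -- The infimum need not be attained: if `τ i = 0` with `i < l`, the path still has value `l` at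
  -- time `0`. Hence the approach through `u > τ i`.
  refine le_antisymm (le_of_forall_gt_imp_ge_of_dense fun u hu ↦ ?_) ?_
  · refine (csInf_le (OrderBot.bddBelow _) ?_ : _ ≤ min u t).trans (min_le_left _ _)
    refine ⟨⟨zero_le, min_le_right _ _⟩, ?_⟩
    rcases le_or_gt t u with htu | hut
    · rwa [min_eq_right htu, chainPath_of_le ht le_rfl]
    · rw [min_eq_left hut.le]
      exact (chainPath_le_iff hτ hkl ⟨zero_le.trans_lt hu, hut⟩ hil).2 ⟨hki, hu.le⟩
  · refine le_csInf ⟨t, ⟨zero_le, le_rfl⟩, by rwa [chainPath_of_le ht le_rfl]⟩ fun s hs ↦ ?_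
    rcases eq_or_lt_of_le hs.1.1 with rfl | hs0
    · have : l ≤ i := by simpa [chainPath_zero] using hs.2
      rw [le_antisymm hil this, hτ.start]
    rcases eq_or_lt_of_le hs.1.2 with rfl | hst
    · exact hit
    · exact ((chainPath_le_iff hτ hkl ⟨hs0, hst⟩ hil).1 hs.2).2

end ChainPath

lemma lastPassage_eq_passage {f : ℕ → ℝ≥0 → ℝ} {k n : ℕ}
    (hf : ∀ i, k ≤ i → i ≤ k + n → Continuous (f i)) (t : ℝ≥0) :
    lastPassage f 0 (k + n) t k = passage f k n t := by
  rcases eq_or_lt_of_le (zero_le (a := t)) with rfl | ht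
  -- At `t = 0` there is no path unless `n = 0`, and then its length is `0`; the convention `sSup ∅
  -- = 0` makes both cases agree.
  · rw [passage_zero]
    have hsub : pathLength f 0 0 (k + n) k '' {π | IsPath 0 0 (k + n) k π} ⊆ {0} := by
      rintro _ ⟨π, hπ, rfl⟩
      have hn : k + n = k := hπ.start.symm.trans hπ.finish
      have hj : jumpTime 0 0 π k = 0 := nonpos_iff_eq_zero.1 hπ.isChain.finish
      simp [pathLength, hn, hj]
    rcases subset_singleton_iff_eq.1 hsub with h | h <;> simp [lastPassage, h]
  · refine IsGreatest.csSup_eq ⟨?_, ?_⟩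
    · obtain ⟨τ, hτ, hlen⟩ := exists_chainLength_eq_passage hf t
      refine ⟨_, hτ.isPath (by omega) ht, ?_⟩
      rw [← hlen]
      exact chainLength_congr f (by omega) t fun i h1 h2 ↦ jumpTime_chainPath hτ ht h1 h2
    · rintro _ ⟨π, hπ, rfl⟩
      exact chainLength_le_passage hf hπ.isChain

end BrownianTASEP

namespace BrownianTASEP

/-! ### The lines as Skorokhod reflections -/

/-- The lines of the Brownian TASEP for a fixed environment. -/
noncomputable def pathLine (m : ℕ) (g : ℕ → ℝ) (f : ℕ → ℝ≥0 → ℝ) (k : ℕ) (t : ℝ≥0) : ℝ :=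
  ⨆ l : Finset.Icc k m, (g l + lastPassage f 0 l t k)

/-- The distance by which line `k + 1` exceeds the free motion of line `k`, or `0`. -/
noncomputable def excess (m : ℕ) (g : ℕ → ℝ) (f : ℕ → ℝ≥0 → ℝ) (k : ℕ) (s : ℝ≥0) : ℝ :=
  max 0 (pathLine m g f (k + 1) s - f k s + f k 0 - g k)

/-- The push that line `k` receives from line `k + 1`: a Skorokhod reflection term. -/
noncomputable def push (m : ℕ) (g : ℕ → ℝ) (f : ℕ → ℝ≥0 → ℝ) (k : ℕ) : ℝ≥0 → ℝ :=
  runSup (excess m g f k)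

section

variable {m : ℕ} {g : ℕ → ℝ} {f : ℕ → ℝ≥0 → ℝ}

lemma le_pathLine {k n : ℕ} (hkm : k + n ≤ m)
    (hf : ∀ i, k ≤ i → i ≤ k + n → Continuous (f i)) (t : ℝ≥0) :
    g (k + n) + passage f k n t ≤ pathLine m g f k t := by
  rw [← lastPassage_eq_passage hf]
  exact le_ciSup (f := fun l : Finset.Icc k m ↦ g l + lastPassage f 0 l t k)
    (finite_range _).bddAbove ⟨k + n, Finset.mem_Icc.2 ⟨by omega, hkm⟩⟩

lemma exists_eq_pathLine {k : ℕ} (hkm : k ≤ m)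
    (hf : ∀ i, k ≤ i → i ≤ m → Continuous (f i)) (t : ℝ≥0) :
    ∃ n, k + n ≤ m ∧ g (k + n) + passage f k n t = pathLine m g f k t := by
  have : Nonempty (Finset.Icc k m) := ⟨⟨k, Finset.mem_Icc.2 ⟨le_rfl, hkm⟩⟩⟩
  obtain ⟨⟨l, hl⟩, h⟩ := exists_eq_ciSup_of_finite
    (f := fun l : Finset.Icc k m ↦ g l + lastPassage f 0 l t k)
  obtain ⟨hkl, hlm⟩ := Finset.mem_Icc.1 hl
  obtain ⟨n, rfl⟩ := Nat.exists_eq_add_of_le hkl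
  exact ⟨n, hlm, by rw [← lastPassage_eq_passage fun i h1 h2 ↦ hf i h1 (h2.trans hlm)]; exact h⟩

lemma pathLine_self (hf : Continuous (f m)) (t : ℝ≥0) :
    pathLine m g f m t = g m + (f m t - f m 0) := by
  obtain ⟨n, hn, h⟩ := exists_eq_pathLine (g := g) (f := f) (le_refl m)
    (fun i h1 h2 ↦ le_antisymm h2 h1 ▸ hf) t
  obtain rfl : n = 0 := by omega
  exact h.symm

lemma continuous_excess {k : ℕ} (hfk : Continuous (f k))
    (hline : Continuous (pathLine m g f (k + 1))) : Continuous (excess m g f k) := by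
  unfold excess; fun_prop

/-- A maximum of suprema is a supremum of maxima; the `0` in `excess` accounts for starting at level
`k` itself. Continuity of line `k + 1` is assumed here because `continuous_pathLine` derives it from
this identity, by induction down from `m`. -/
lemma pathLine_eq_add_push_aux {k : ℕ} (hkm : k < m)
    (hf : ∀ i, k ≤ i → i ≤ m → Continuous (f i))
    (hline : Continuous (pathLine m g f (k + 1))) (t : ℝ≥0) :
    pathLine m g f k t = g k + (f k t - f k 0) + push m g f k t := by
  have hk := hf k le_rfl hkm.le
  have hZ := continuous_excess (g := g) hk hline
  have hf' {n : ℕ} (hn : k + 1 + n ≤ m) : ∀ i, k + 1 ≤ i → i ≤ k + 1 + n → Continuous (f i) :=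
    fun i h1 h2 ↦ hf i (by omega) (by omega)
  have hW {n : ℕ} (hn : k + 1 + n ≤ m) : Continuous fun s ↦ passage f (k + 1) n s - f k s :=
    (continuous_passage (hf' hn)).sub hk
  apply le_antisymm
  · obtain ⟨n, hn, h⟩ := exists_eq_pathLine (g := g) hkm.le hf t
    rw [← h]
    cases n with
    | zero =>
      have : excess m g f k 0 ≤ push m g f k t := le_runSup hZ zero_le
      have : 0 ≤ excess m g f k 0 := le_max_left _ _
      simp only [passage, add_zero]
      linarith
    | succ n =>
      have e : k + (n + 1) = k + 1 + n := by omega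
      rw [e] at hn
      obtain ⟨s, hst, hs⟩ := exists_eq_runSup (hW hn) t
      have h1 : excess m g f k s ≤ push m g f k t := le_runSup hZ hst
      have h2 : _ ≤ excess m g f k s := le_max_right _ _
      have h3 := le_pathLine (g := g) hn (hf' hn) s
      simp only [passage, ← hs, e]
      linarith
  · obtain ⟨s, hst, hs⟩ := exists_eq_runSup hZ t
    rw [push, ← hs, excess]
    rcases max_choice 0 (pathLine m g f (k + 1) s - f k s + f k 0 - g k) with h | h <;> rw [h]
    · simpa [passage] using le_pathLine (g := g) (f := f) (k := k) (n := 0) hkm.le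
        (fun i h1 h2 ↦ hf i h1 (by omega)) t
    · obtain ⟨n, hn, h⟩ := exists_eq_pathLine (g := g) (k := k + 1) hkm
        (fun i h1 h2 ↦ hf i (by omega) h2) s
      have h1 := le_pathLine (m := m) (g := g) (f := f) (k := k) (n := n + 1) (by omega)
        (fun i h1 h2 ↦ hf i h1 (by omega)) t
      have h2 := le_runSup (hW hn) hst
      have e : k + (n + 1) = k + 1 + n := by omega
      simp only [passage, e] at h1
      linarith

lemma continuous_pathLine {k : ℕ} (hkm : k ≤ m)
    (hf : ∀ i, k ≤ i → i ≤ m → Continuous (f i)) : Continuous (pathLine m g f k) := by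
  induction hkm using Nat.decreasingInduction with
  | self =>
    have hm := hf m le_rfl le_rfl
    rw [show pathLine m g f m = _ from funext fun t ↦ pathLine_self hm t]
    fun_prop
  | of_succ k hk ih =>
    have hk' := hf k le_rfl (by omega)
    have hline := ih fun i h1 h2 ↦ hf i (by omega) h2
    have hpush : Continuous (push m g f k) := continuous_runSup (continuous_excess hk' hline)
    rw [show pathLine m g f k = _ from
      funext fun t ↦ pathLine_eq_add_push_aux (by omega) hf hline t]
    fun_prop

variable {k : ℕ} (hkm : k < m) (hf : ∀ i, k ≤ i → i ≤ m → Continuous (f i))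
include hkm hf

lemma continuous_excess_of_lt : Continuous (excess m g f k) :=
  continuous_excess (hf k le_rfl hkm.le)
    (continuous_pathLine hkm fun i h1 h2 ↦ hf i (by omega) h2)

lemma continuous_push : Continuous (push m g f k) :=
  continuous_runSup (continuous_excess_of_lt hkm hf)

lemma monotone_push : Monotone (push m g f k) :=
  runSup_mono (continuous_excess_of_lt hkm hf)

lemma pathLine_eq_add_push (t : ℝ≥0) :
    pathLine m g f k t = g k + (f k t - f k 0) + push m g f k t :=
  pathLine_eq_add_push_aux hkm hf (continuous_pathLine hkm fun i h1 h2 ↦ hf i (by omega) h2) t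

lemma push_nonneg (t : ℝ≥0) : 0 ≤ push m g f k t :=
  (le_max_left _ _).trans (le_runSup (continuous_excess_of_lt hkm hf) (zero_le (a := t)))

end

lemma pathLine_zero {m : ℕ} {g : ℕ → ℝ} {f : ℕ → ℝ≥0 → ℝ} {k : ℕ} (hk : 1 ≤ k) (hkm : k ≤ m)
    (hg : AntitoneOn g (Icc 1 m)) (hf : ∀ i, k ≤ i → i ≤ m → Continuous (f i)) :
    pathLine m g f k 0 = g k := by
  obtain ⟨n, hn, h⟩ := exists_eq_pathLine (g := g) hkm hf 0
  have h1 := le_pathLine (g := g) (n := 0) hkm (fun i h1 h2 ↦ hf i h1 (by omega)) 0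
  rw [passage_zero, add_zero] at h h1
  exact le_antisymm (h ▸ hg ⟨hk, hkm⟩ ⟨by omega, hn⟩ (by omega)) h1

section

variable {m : ℕ} {g : ℕ → ℝ} {f : ℕ → ℝ≥0 → ℝ} {k : ℕ} (hk : 1 ≤ k) (hkm : k < m)
  (hg : AntitoneOn g (Icc 1 m)) (hf : ∀ i, k ≤ i → i ≤ m → Continuous (f i))
include hk hkm hg hf

lemma push_zero : push m g f k 0 = 0 := by
  have h := pathLine_eq_add_push (g := g) hkm hf 0
  rw [pathLine_zero hk hkm.le hg hf] at h
  linarith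

lemma pathLine_zero_succ : pathLine m g f (k + 1) 0 = g (k + 1) :=
  pathLine_zero (by omega) hkm hg fun i h1 h2 ↦ hf i (by omega) h2

end

section

variable {m : ℕ} {g : ℕ → ℝ} {f : ℕ → ℝ≥0 → ℝ} {k : ℕ} (hkm : k < m)
  (hf : ∀ i, k ≤ i → i ≤ m → Continuous (f i))
include hkm hf

lemma pathLine_succ_le (t : ℝ≥0) : pathLine m g f (k + 1) t ≤ pathLine m g f k t := by
  have h1 : excess m g f k t ≤ push m g f k t := le_runSup (continuous_excess_of_lt hkm hf) le_rfl
  have h2 : _ ≤ excess m g f k t := le_max_right _ _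
  rw [pathLine_eq_add_push hkm hf]
  linarith

/-- The push is locally constant away from the collisions of the two lines. -/
lemma exists_push_le {t : ℝ≥0} (ht : pathLine m g f k t ≠ pathLine m g f (k + 1) t) :
    ∃ a b, Icc a b ∈ nhds t ∧ push m g f k b ≤ push m g f k a := by
  have hline : Continuous (pathLine m g f (k + 1)) :=
    continuous_pathLine hkm fun i h1 h2 ↦ hf i (by omega) h2
  have hk := hf k le_rfl hkm.le
  have hZ := continuous_excess_of_lt (g := g) hkm hf
  have hpush := continuous_push (g := g) hkm hf
  have hlt : pathLine m g f (k + 1) t - f k t + f k 0 - g k < push m g f k t := by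
    have h := lt_of_le_of_ne (pathLine_succ_le (g := g) hkm hf t) ht.symm
    rw [pathLine_eq_add_push hkm hf] at h
    linarith
  -- A level `v` separates the gap from the push on a whole interval `[a, b]` around `t`. A
  -- maximiser of `excess` over `[0, b]` then lies before `a`, or has value `0` or less than `v`; in
  -- each case it does not exceed the push at `a`.
  obtain ⟨v, hv1, hv2⟩ := exists_between hlt
  have hU : {s | pathLine m g f (k + 1) s - f k s + f k 0 - g k < v ∧ v < push m g f k s}
      ∈ nhds t :=
    (((by fun_prop : Continuous fun s ↦ pathLine m g f (k + 1) s - f k s + f k 0 - g k).tendsto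
      t).eventually_lt_const hv1).and ((hpush.tendsto t).eventually_const_lt hv2)
  obtain ⟨a, b, hab, hmem, hsub⟩ := exists_Icc_mem_subset_of_mem_nhds hU
  refine ⟨a, b, hmem, ?_⟩
  obtain ⟨s, hsb, hs⟩ := exists_eq_runSup hZ b
  rw [push, ← hs]
  rcases le_total s a with hsa | has
  · exact le_runSup hZ hsa
  · exact max_le (push_nonneg hkm hf a)
      ((hsub ⟨has, hsb⟩).1.trans (hsub ⟨le_rfl, hab.1.trans hab.2⟩).2).le

end

/-! ### Stieltjes measures and collision times. -/

section Stieltjes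

variable {A : StieltjesFunction ℝ≥0}

lemma measure_Icc_eq_zero (hA : Continuous A) {a b : ℝ≥0} (h : A b ≤ A a) :
    A.measure (Icc a b) = 0 := by
  rw [StieltjesFunction.measure_Icc, hA.continuousAt.continuousWithinAt.leftLim_eq]
  exact ENNReal.ofReal_of_nonpos (by linarith)

/-- If the measure of `A` does not charge `{X ≠ Y}`, then it is carried by the times after the first
collision of `X` and `Y`. -/
lemma integral_indicator_collisionTime {X Y : ℝ≥0 → ℝ}
    (h0 : A 0 = 0) (h : A.measure {s | X s ≠ Y s} = 0) (t : ℝ≥0) :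
    ∫ s in Ioc 0 t, indicator {s : ℝ≥0 | collisionTime X Y ≤ (s : ℝ≥0∞)}
      (fun _ ↦ (1 : ℝ)) s ∂A.measure = A t := by
  have hae : ∀ᵐ s ∂A.measure.restrict (Ioc 0 t),
      indicator {s : ℝ≥0 | collisionTime X Y ≤ (s : ℝ≥0∞)} (fun _ ↦ (1 : ℝ)) s = 1 := by
    refine ae_restrict_of_ae ?_
    filter_upwards [show ∀ᵐ s ∂A.measure, X s = Y s from h] with s hs
    have hle : collisionTime X Y ≤ s := iInf₂_le s hs
    exact indicator_of_mem (s := {s : ℝ≥0 | collisionTime X Y ≤ s}) hle _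
  rw [integral_congr_ae hae, integral_const, smul_eq_mul, mul_one, measureReal_restrict_apply_univ,
    measureReal_def, StieltjesFunction.measure_Ioc, h0, sub_zero,
    ENNReal.toReal_ofReal (h0 ▸ A.mono zero_le)]

end Stieltjes

lemma collisionTime_pos {X Y : ℝ≥0 → ℝ} (hX : Continuous X) (hY : Continuous Y)
    (h : X 0 ≠ Y 0) : 0 < collisionTime X Y := by
  have hU : {s | X s ≠ Y s} ∈ nhds 0 := (isOpen_ne_fun hX hY).mem_nhds h
  obtain ⟨c, hc, hsub⟩ := exists_Ico_subset_of_mem_nhds hU ⟨1, zero_lt_one⟩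
  refine (ENNReal.coe_pos.2 hc).trans_le (le_iInf₂ fun t ht ↦ ?_)
  by_contra! hlt
  exact hsub ⟨zero_le, ENNReal.coe_lt_coe.1 hlt⟩ ht

end BrownianTASEP

/-! ### Independence of increments and the martingale property. -/

namespace BrownianTASEP

/-- The joint law of the triple is a triple product, which may be bracketed either way. -/
lemma indepFun_prodMk_of_indepFun_prodMk {Ω α β γ : Type*} {mΩ : MeasurableSpace Ω}
    [MeasurableSpace α] [MeasurableSpace β] [MeasurableSpace γ] {P : Measure Ω}
    [IsProbabilityMeasure P] {X : Ω → α} {Y : Ω → β} {Z : Ω → γ} (hX : Measurable X)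
    (hY : Measurable Y) (hZ : Measurable Z) (hXY : IndepFun X Y P)
    (hXYZ : IndepFun (fun ω ↦ (X ω, Y ω)) Z P) : IndepFun X (fun ω ↦ (Y ω, Z ω)) P := by
  have hYZ : IndepFun Y Z P := hXYZ.comp measurable_snd measurable_id
  rw [indepFun_iff_map_prod_eq_prod_map_map hX.aemeasurable (hY.prodMk hZ).aemeasurable,
    hYZ.map_prod_eq_prod_map_map hY.aemeasurable hZ.aemeasurable]
  have : SFinite (P.map Z) := inferInstance
  rw [← Measure.prodAssoc_prod, ← hXY.map_prod_eq_prod_map_map hX.aemeasurable hY.aemeasurable,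
    ← hXYZ.map_prod_eq_prod_map_map (hX.prodMk hY).aemeasurable hZ.aemeasurable,
    Measure.map_map (by fun_prop) (by fun_prop)]
  rfl

variable {Ω : Type*} [mΩ : MeasurableSpace Ω] {P : Measure Ω}

namespace IsRateTwoBrownian

variable {X : ℝ≥0 → Ω → ℝ}

lemma ae_zero (hX : IsRateTwoBrownian X P) : ∀ᵐ ω ∂P, X 0 ω = 0 := by
  filter_upwards [hX.eval_zero_ae_eq_zero] with ω hω
  simpa using hω

lemma integrable (hX : IsRateTwoBrownian X P) (t : ℝ≥0) : Integrable (X t) P := by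
  refine ((hX.integrable_eval t).const_mul √2).congr (.of_forall fun ω ↦ ?_)
  simp

lemma integral (hX : IsRateTwoBrownian X P) (t : ℝ≥0) : P[X t] = 0 := by
  have h := hX.integral_eval t
  rw [integral_const_mul] at h
  exact (mul_eq_zero.1 h).resolve_left (by positivity)

lemma indepFun_sub (hX : IsRateTwoBrownian X P) {s t : ℝ≥0} (hst : s ≤ t) :
    IndepFun (fun ω ↦ X t ω - X s ω) (fun ω (u : Iic s) ↦ X u ω) P := by
  have h := (hX.indepFun_shift s).comp (φ := fun x ↦ √2 * x (t - s))
    (ψ := fun x u ↦ √2 * x u) (by fun_prop) (by fun_prop)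
  convert h using 2 with ω ω
  · have : s + (t - s) = t := add_tsub_cancel_of_le hst
    simp only [this, Function.comp_apply]
    rw [← mul_sub, mul_inv_cancel_left₀ (by positivity)]
  · ext u
    simp only [Function.comp_apply]
    rw [mul_inv_cancel_left₀ (by positivity)]

end IsRateTwoBrownian

variable {m : ℕ} {B : ℕ → ℝ≥0 → Ω → ℝ}

/-- The increment is independent of the past of line `k` by the Markov property, and that pair is
independent of all the other lines; regrouping combines the two. -/
lemma indepFun_sub_past [IsProbabilityMeasure P]
    (hmeas : ∀ i ∈ Finset.Icc 1 m, ∀ t, Measurable (B i t))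
    (hindep : iIndepFun (fun (i : Finset.Icc 1 m) (ω : Ω) (t : ℝ≥0) ↦ B i t ω) P)
    {k : ℕ} (hk : k ∈ Finset.Icc 1 m) (hBM : IsRateTwoBrownian (B k) P)
    {s t : ℝ≥0} (hst : s ≤ t) :
    IndepFun (fun ω ↦ B k t ω - B k s ω)
      (fun ω (u : Iic s) (i : Finset.Icc 1 m) ↦ B i u ω) P := by
  have hmeas' (i : Finset.Icc 1 m) (t : ℝ≥0) : Measurable (B i t) := hmeas i i.2 t
  have hk' (t : ℝ≥0) : Measurable (B k t) := hmeas k hk t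
  set k' : Finset.Icc 1 m := ⟨k, hk⟩
  have h1 := hindep.indepFun_finset {k'} {k'}ᶜ
    (Finset.disjoint_left.2 fun i hi ↦ by simpa using hi) (fun i ↦ by fun_prop)
  have h2 := h1.comp
    (φ := fun x : ({k'} : Finset (Finset.Icc 1 m)) → ℝ≥0 → ℝ ↦
      (x ⟨k', by simp⟩ t - x ⟨k', by simp⟩ s, fun u : Iic s ↦ x ⟨k', by simp⟩ u))
    (ψ := id) (by fun_prop) measurable_id
  have h3 := indepFun_prodMk_of_indepFun_prodMk (Y := fun ω (u : Iic s) ↦ B k u ω)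
    (by fun_prop) (by fun_prop) (by fun_prop) (hBM.indepFun_sub hst) h2
  -- Reassemble the past of all lines from that of line `k` and the full trajectories of the others.
  have h4 := h3.comp (φ := id)
    (ψ := fun (x : (Iic s → ℝ) × (({k'}ᶜ : Finset (Finset.Icc 1 m)) → ℝ≥0 → ℝ)) (u : Iic s) (i : Finset.Icc 1 m) ↦
      if h : i = k' then x.1 u else x.2 ⟨i, by simpa using h⟩ u) measurable_id (by
        refine measurable_pi_lambda _ fun u ↦ measurable_pi_lambda _ fun i ↦ ?_
        by_cases h : i = k'
        · simp only [h, dite_true]; fun_prop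
        · simp only [h, dite_false]; fun_prop)
  refine h4.congr .rfl (.of_forall fun ω ↦ funext₂ fun u i ↦ ?_)
  by_cases h : i = k'
  · simp [h, k']
  · simp [h]

lemma stronglyMeasurable_driving (hmeas : ∀ i ∈ Finset.Icc 1 m, ∀ t, Measurable (B i t))
    {k : ℕ} (hk : k ∈ Finset.Icc 1 m) {s t : ℝ≥0} (hst : s ≤ t) :
    StronglyMeasurable[drivingFiltration m B hmeas t] (B k s) := by
  have h := (Filtration.stronglyAdapted_natural (fun t ↦ (measurable_pi_lambda _
    fun i : Finset.Icc 1 m ↦ hmeas i.1 i.2 t).stronglyMeasurable) s).mono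
    ((drivingFiltration m B hmeas).mono hst)
  exact ((measurable_pi_apply (⟨k, hk⟩ : Finset.Icc 1 m)).comp h.measurable).stronglyMeasurable

/-- The increments of a driving Brownian motion are independent of the past of all of them, so it
is a martingale in the joint filtration, up to its (almost surely vanishing) initial value. -/
lemma martingale_sub_zero [IsProbabilityMeasure P]
    (hmeas : ∀ i ∈ Finset.Icc 1 m, ∀ t, Measurable (B i t))
    (hindep : iIndepFun (fun (i : Finset.Icc 1 m) (ω : Ω) (t : ℝ≥0) ↦ B i t ω) P)
    {k : ℕ} (hk : k ∈ Finset.Icc 1 m) (hBM : IsRateTwoBrownian (B k) P) (c : ℝ) :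
    Martingale (fun t ω ↦ c + (B k t ω - B k 0 ω)) (drivingFiltration m B hmeas) P := by
  have hadapt (t : ℝ≥0) : StronglyMeasurable[drivingFiltration m B hmeas t]
      (fun ω ↦ c + (B k t ω - B k 0 ω)) :=
    stronglyMeasurable_const.add ((stronglyMeasurable_driving hmeas hk le_rfl).sub
      (stronglyMeasurable_driving hmeas hk zero_le))
  refine ⟨hadapt, fun s t hst ↦ ?_⟩
  have hle := (drivingFiltration m B hmeas).le s
  have hint (t : ℝ≥0) : Integrable (fun ω ↦ c + (B k t ω - B k 0 ω)) P :=
    (integrable_const c).add ((hBM.integrable t).sub (hBM.integrable 0))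
  have hinc : Measurable (fun ω ↦ B k t ω - B k s ω) := (hmeas k hk t).sub (hmeas k hk s)
  have hind : Indep (MeasurableSpace.comap (fun ω ↦ B k t ω - B k s ω) inferInstance)
      (drivingFiltration m B hmeas s) P := by
    rw [drivingFiltration, Filtration.natural_eq_comap]
    exact indepFun_sub_past hmeas hindep hk hBM hst
  have h1 : P[fun ω ↦ B k t ω - B k s ω | drivingFiltration m B hmeas s] =ᵐ[P] fun _ ↦ 0 := by
    have h := condExp_indep_eq hinc.comap_le hle
      (comap_measurable (fun ω ↦ B k t ω - B k s ω)).stronglyMeasurable hind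
    rwa [integral_sub (hBM.integrable t) (hBM.integrable s), hBM.integral, hBM.integral,
      sub_zero] at h
  have h2 := condExp_add (hint s) ((hBM.integrable t).sub (hBM.integrable s))
    (drivingFiltration m B hmeas s)
  rw [condExp_of_stronglyMeasurable hle (hadapt s) (hint s)] at h2
  have h3 : (fun ω ↦ c + (B k t ω - B k 0 ω)) =
      (fun ω ↦ c + (B k s ω - B k 0 ω)) + (B k t - B k s) := by
    ext ω; simp only [Pi.add_apply, Pi.sub_apply]; ring
  change P[fun ω ↦ c + (B k t ω - B k 0 ω) | drivingFiltration m B hmeas s] =ᵐ[P]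
    fun ω ↦ c + (B k s ω - B k 0 ω)
  rw [h3]
  filter_upwards [h1, h2] with ω hω1 hω2
  rw [hω2, Pi.add_apply]
  exact (congrArg _ hω1).trans (add_zero _)

end BrownianTASEP

/-! ### Adaptedness, and the push as a Stieltjes measure. -/

namespace BrownianTASEP

section Measurability

variable {Ω : Type*}

lemma stronglyMeasurable_runSup {m : MeasurableSpace Ω} {Z : Ω → ℝ≥0 → ℝ}
    (hZ : ∀ ω, Continuous (Z ω)) {t : ℝ≥0}
    (h : ∀ s ≤ t, StronglyMeasurable fun ω ↦ Z ω s) :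
    StronglyMeasurable fun ω ↦ runSup (Z ω) t := by
  simp_rw [runSup_eq_iSup_denseSeq (hZ _)]
  exact (Measurable.iSup fun n ↦ (h _ (min_le_left _ _)).measurable).stronglyMeasurable

lemma continuous_driving {m : ℕ} {B : ℕ → ℝ≥0 → Ω → ℝ}
    (hcont : ∀ i ∈ Finset.Icc 1 m, ∀ ω, Continuous fun t ↦ B i t ω) {k : ℕ} (hk : 1 ≤ k) (ω : Ω) :
    ∀ i, k ≤ i → i ≤ m → Continuous fun t ↦ B i t ω :=
  fun i h1 h2 ↦ hcont i (Finset.mem_Icc.2 ⟨hk.trans h1, h2⟩) ω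

variable [mΩ : MeasurableSpace Ω] {m : ℕ} {B : ℕ → ℝ≥0 → Ω → ℝ} {g : ℕ → ℝ}
  (hmeas : ∀ i ∈ Finset.Icc 1 m, ∀ t, Measurable (B i t))
  (hcont : ∀ i ∈ Finset.Icc 1 m, ∀ ω, Continuous fun t ↦ B i t ω)
include hcont

lemma stronglyAdapted_push_of_line {k : ℕ} (hk : 1 ≤ k) (hkm : k < m)
    (hline : StronglyAdapted (drivingFiltration m B hmeas) (line m g B (k + 1))) :
    StronglyAdapted (drivingFiltration m B hmeas)
      (fun t ω ↦ push m g (fun i s ↦ B i s ω) k t) := by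
  intro t
  refine stronglyMeasurable_runSup
    (fun ω ↦ continuous_excess_of_lt hkm (continuous_driving hcont hk ω)) fun s hs ↦ ?_
  have hk' : k ∈ Finset.Icc 1 m := Finset.mem_Icc.2 ⟨hk, hkm.le⟩
  have hdiff : StronglyMeasurable[drivingFiltration m B hmeas t]
      fun ω ↦ line m g B (k + 1) s ω - B k s ω + B k 0 ω - g k :=
    ((((hline s).mono ((drivingFiltration m B hmeas).mono hs)).sub
      (stronglyMeasurable_driving hmeas hk' hs)).add
      (stronglyMeasurable_driving hmeas hk' zero_le)).sub stronglyMeasurable_const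
  exact (measurable_const.max hdiff.measurable).stronglyMeasurable

lemma stronglyAdapted_line {k : ℕ} (hk : 1 ≤ k) (hkm : k ≤ m) :
    StronglyAdapted (drivingFiltration m B hmeas) (line m g B k) := by
  have hdrive {k : ℕ} (hk : 1 ≤ k) (hkm : k ≤ m) (t : ℝ≥0) :
      StronglyMeasurable[drivingFiltration m B hmeas t]
        fun ω ↦ g k + (B k t ω - B k 0 ω) :=
    have hk' : k ∈ Finset.Icc 1 m := Finset.mem_Icc.2 ⟨hk, hkm⟩
    stronglyMeasurable_const.add ((stronglyMeasurable_driving hmeas hk' le_rfl).sub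
      (stronglyMeasurable_driving hmeas hk' zero_le))
  induction hkm using Nat.decreasingInduction with
  | self =>
    intro t
    rw [show line m g B m t = _ from
      funext fun ω ↦ pathLine_self (continuous_driving hcont hk ω m le_rfl le_rfl) t]
    exact hdrive hk le_rfl t
  | of_succ k hkm ih =>
    intro t
    rw [show line m g B k t = _ from
      funext fun ω ↦ pathLine_eq_add_push hkm (continuous_driving hcont hk ω) t]
    exact (hdrive hk (by omega) t).add
      (stronglyAdapted_push_of_line hmeas hcont hk hkm (ih (by omega)) t)

lemma stronglyAdapted_push {k : ℕ} (hk : 1 ≤ k) (hkm : k < m) :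
    StronglyAdapted (drivingFiltration m B hmeas)
      (fun t ω ↦ push m g (fun i s ↦ B i s ω) k t) :=
  stronglyAdapted_push_of_line hmeas hcont hk hkm
    (stronglyAdapted_line hmeas hcont (by omega) hkm)

end Measurability

/-- The push as a Stieltjes function. -/
noncomputable def pushStieltjes {m : ℕ} (g : ℕ → ℝ) {f : ℕ → ℝ≥0 → ℝ} {k : ℕ} (hkm : k < m)
    (hf : ∀ i, k ≤ i → i ≤ m → Continuous (f i)) : StieltjesFunction ℝ≥0 where
  toFun := push m g f k
  mono' := monotone_push hkm hf
  right_continuous' _ := (continuous_push hkm hf).continuousWithinAt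

lemma measure_pushStieltjes_ne {m : ℕ} {g : ℕ → ℝ} {f : ℕ → ℝ≥0 → ℝ} {k : ℕ} (hkm : k < m)
    (hf : ∀ i, k ≤ i → i ≤ m → Continuous (f i)) :
    (pushStieltjes g hkm hf).measure {s | pathLine m g f k s ≠ pathLine m g f (k + 1) s} = 0 := by
  -- Each non-collision time has a neighbourhood on which the push is constant, and local nullity
  -- suffices.
  refine measure_null_of_locally_null _ fun t ht ↦ ?_
  obtain ⟨a, b, hmem, hle⟩ := exists_push_le hkm hf ht
  exact ⟨_, mem_nhdsWithin_of_mem_nhds hmem, measure_Icc_eq_zero (continuous_push hkm hf) hle⟩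

/-! ### The semimartingale decomposition. -/

section Semimartingale

variable {Ω : Type*} [mΩ : MeasurableSpace Ω] {P : Measure Ω} [IsProbabilityMeasure P]
  {m : ℕ} {B : ℕ → ℝ≥0 → Ω → ℝ}

lemma isContinuousLocalMartingale_driving
    (hmeas : ∀ i ∈ Finset.Icc 1 m, ∀ t, Measurable (B i t))
    (hcont : ∀ i ∈ Finset.Icc 1 m, ∀ ω, Continuous fun t ↦ B i t ω)
    (hindep : iIndepFun (fun (i : Finset.Icc 1 m) (ω : Ω) (t : ℝ≥0) ↦ B i t ω) P)
    {k : ℕ} (hk : k ∈ Finset.Icc 1 m) (hBM : IsRateTwoBrownian (B k) P) (c : ℝ) :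
    IsContinuousLocalMartingale (fun t ω ↦ c + (B k t ω - B k 0 ω))
      (drivingFiltration m B hmeas) P where
  adapted := (martingale_sub_zero hmeas hindep hk hBM c).1
  continuous ω := continuous_const.add ((hcont k hk ω).sub continuous_const)
  local_martingale := Locally.of_prop (martingale_sub_zero hmeas hindep hk hBM c)

lemma isContinuousSemimartingale_line {g : ℕ → ℝ} (hg : AntitoneOn g (Icc 1 m))
    (hmeas : ∀ i ∈ Finset.Icc 1 m, ∀ t, Measurable (B i t))
    (hcont : ∀ i ∈ Finset.Icc 1 m, ∀ ω, Continuous fun t ↦ B i t ω)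
    (hindep : iIndepFun (fun (i : Finset.Icc 1 m) (ω : Ω) (t : ℝ≥0) ↦ B i t ω) P)
    {k : ℕ} (hk : 1 ≤ k) (hkm : k ≤ m) (hBM : IsRateTwoBrownian (B k) P) :
    IsContinuousSemimartingale (line m g B k) (drivingFiltration m B hmeas) P := by
  -- The constant `g k` goes into the martingale part, so that the finite variation part starts from
  -- `0`.
  have hM := isContinuousLocalMartingale_driving hmeas hcont hindep
    (Finset.mem_Icc.2 ⟨hk, hkm⟩) hBM (g k)
  rcases eq_or_lt_of_le hkm with rfl | hkm
  · refine ⟨_, fun _ _ ↦ 0, hM, ⟨fun _ ↦ stronglyMeasurable_const, fun _ ↦ continuous_const,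
      fun _ ↦ rfl, fun _ ↦ (monotoneOn_const.locallyBoundedVariationOn)⟩, fun t ω ↦ ?_⟩
    rw [add_zero]
    exact pathLine_self (continuous_driving hcont hk ω k le_rfl le_rfl) t
  · exact ⟨_, fun t ω ↦ push m g (fun i s ↦ B i s ω) k t, hM,
      ⟨stronglyAdapted_push hmeas hcont hk hkm,
        fun ω ↦ continuous_push hkm (continuous_driving hcont hk ω),
        fun ω ↦ push_zero hk hkm hg (continuous_driving hcont hk ω),
        fun ω ↦ ((monotone_push hkm
          (continuous_driving hcont hk ω)).monotoneOn _).locallyBoundedVariationOn⟩,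
      fun t ω ↦ pathLine_eq_add_push hkm (continuous_driving hcont hk ω) t⟩

end Semimartingale

end BrownianTASEP

theorem mainTheorem6 {Ω : Type*} [mΩ : MeasurableSpace Ω] (P : Measure Ω) [IsProbabilityMeasure P]
    (m : ℕ) (hm : 1 ≤ m) (g : ℕ → ℝ) (hg : AntitoneOn g (Set.Icc 1 m))
    (B : ℕ → ℝ≥0 → Ω → ℝ)
    (hmeas : ∀ i ∈ Finset.Icc 1 m, ∀ t, Measurable (B i t))
    (hcont : ∀ i ∈ Finset.Icc 1 m, ∀ ω, Continuous fun t ↦ B i t ω)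
    (hBM : ∀ i ∈ Finset.Icc 1 m, BrownianTASEP.IsRateTwoBrownian (B i) P)
    (hindep : iIndepFun (fun (i : Finset.Icc 1 m) (ω : Ω) (t : ℝ≥0) ↦ B i t ω) P) :
    (∃ α : ℕ → Ω → StieltjesFunction ℝ≥0, ∀ k : ℕ, 1 ≤ k → k < m →
      (∀ ω, Continuous (α k ω)) ∧
      (∀ ω, α k ω 0 = 0) ∧
      StronglyAdapted (BrownianTASEP.drivingFiltration m B hmeas) (fun t ω ↦ α k ω t) ∧
      (∀ᵐ ω ∂P, (α k ω).measure
        {s | BrownianTASEP.line m g B k s ω ≠ BrownianTASEP.line m g B (k + 1) s ω} = 0) ∧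
      (∀ᵐ ω ∂P, ∀ t : ℝ≥0,
        BrownianTASEP.line m g B k t ω = g k + B k t ω + α k ω t ∧
        BrownianTASEP.line m g B k t ω = g k + B k t ω +
          ∫ s in Set.Ioc 0 t, Set.indicator
            {s : ℝ≥0 | BrownianTASEP.collisionTime (fun u ↦ BrownianTASEP.line m g B k u ω)
              (fun u ↦ BrownianTASEP.line m g B (k + 1) u ω) ≤ (s : ℝ≥0∞)}
            (fun _ ↦ (1 : ℝ)) s ∂(α k ω).measure) ∧
      (g (k + 1) < g k →
        ∀ᵐ ω ∂P, 0 < BrownianTASEP.collisionTime (fun u ↦ BrownianTASEP.line m g B k u ω)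
          (fun u ↦ BrownianTASEP.line m g B (k + 1) u ω))) ∧
    ∀ k : ℕ, 1 ≤ k → k ≤ m →
      BrownianTASEP.IsContinuousSemimartingale (BrownianTASEP.line m g B k)
        (BrownianTASEP.drivingFiltration m B hmeas) P := by
  have hf {k : ℕ} (hk : 1 ≤ k) (ω : Ω) := BrownianTASEP.continuous_driving hcont hk ω
  refine ⟨⟨fun k ω ↦ if h : 1 ≤ k ∧ k < m then
    BrownianTASEP.pushStieltjes g h.2 (hf h.1 ω) else 0, fun k hk hkm ↦ ?_⟩,
    fun k hk hkm ↦ BrownianTASEP.isContinuousSemimartingale_line hg hmeas hcont hindep hk hkm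
      (hBM k (Finset.mem_Icc.2 ⟨hk, hkm⟩))⟩
  have hfk := hf hk
  simp only [dif_pos (show 1 ≤ k ∧ k < m from ⟨hk, hkm⟩)]
  have hzero (ω : Ω) : BrownianTASEP.pushStieltjes g hkm (hfk ω) 0 = 0 :=
    BrownianTASEP.push_zero hk hkm hg (hfk ω)
  have hnull (ω : Ω) := BrownianTASEP.measure_pushStieltjes_ne (g := g) hkm (hfk ω)
  refine ⟨fun ω ↦ BrownianTASEP.continuous_push hkm (hfk ω), hzero,
    BrownianTASEP.stronglyAdapted_push hmeas hcont hk hkm, .of_forall hnull, ?_, ?_⟩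
  -- Only here is a null set discarded: `B k 0 = 0` holds merely almost surely.
  · filter_upwards [(hBM k (Finset.mem_Icc.2 ⟨hk, hkm.le⟩)).ae_zero] with ω hω t
    have h : BrownianTASEP.line m g B k t ω =
        g k + B k t ω + BrownianTASEP.pushStieltjes g hkm (hfk ω) t := by
      have h := BrownianTASEP.pathLine_eq_add_push (g := g) hkm (hfk ω) t
      rwa [hω, sub_zero] at h
    refine ⟨h, ?_⟩
    have hint := BrownianTASEP.integral_indicator_collisionTime (hzero ω) (hnull ω) t
    exact h.trans (congrArg _ hint.symm)
  · refine fun hlt ↦ .of_forall fun ω ↦ BrownianTASEP.collisionTime_pos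
      (BrownianTASEP.continuous_pathLine hkm.le (hfk ω))
      (BrownianTASEP.continuous_pathLine hkm (hf (by omega) ω)) ?_
    have h0 := BrownianTASEP.pathLine_zero hk hkm.le hg (hfk ω)
    have h1 := BrownianTASEP.pathLine_zero_succ hk hkm hg (hfk ω)
    exact fun h ↦ hlt.ne (h1.symm.trans (h.symm.trans h0))
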